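/- Let $L$ be a first-order language, let $\mathfrak{C}$ be a (nonempty) $L$-structure, for instance a monster model of a complete $L$-theory $T$, and let $\varphi(\bar x;\bar y)$ be a partitioned $L$-formula, where $\bar x,\bar y$ are finite tuples of variables. Write $\theta^1=\theta$ and $\theta^0=\neg\theta$; a set of formulas with parameters in $\mathfrak{C}$ is called consistent if it is finitely satisfiable in $\mathfrak{C}$. A set $B\subseteq\mathfrak{C}^{\mathrm{lg}(\bar y)}$ is $\varphi$-independent if $\{\varphi(\bar x;\bar b)^{s(\bar b)}:\bar b\in B\}$ is consistent for every $s:B\to\{0,1\}$, and $\varphi$ is dependent if there is a largest $N<\omega$ such that some $\varphi$-independent set has exactly $N$ elements. For $B\subseteq\mathfrak{C}^{\mathrm{lg}(\bar y)}$ let $S_\varphi(B)$ be the set of $\varphi$-types with domain $B$, i.e. of consistent sets of formulas of the form $\varphi(\bar x;\bar b)^t$ with $\bar b\in B$, $t<2$, that contain for every $\bar b\in B$ one of $\varphi(\bar x;\bar b)$, $\neg\varphi(\bar x;\bar b)$. For $N<\omega$ let \[ \Delta_{N,\varphi}(\bar z_0,\dots,\bar z_N)=\Bigl\{\exists\bar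 x\bigwedge_{i\le N}\varphi(\bar x;\bar z_i)^{s(i)} : s\in{}^{N+1}2\Bigr\}. \] For a partial order $(P;\unlhd)$, a sequence $\langle\bar b_i:i\in P\rangle$ of elements of $\mathfrak{C}^{\mathrm{lg}(\bar y)}$ is $\Delta_{N,\varphi}$-indiscernible if, whenever $i_0,\dots,i_N\in P$ are distinct, $j_0,\dots,j_N\in P$ are distinct, and $i_k\unlhd i_l\Leftrightarrow j_k\unlhd j_l$ for all $k,l\le N$, the tuples $(\bar b_{i_0},\dots,\bar b_{i_N})$ and $(\bar b_{j_0},\dots,\bar b_{j_N})$ satisfy in $\mathfrak{C}$ the same formulas of $\Delta_{N,\varphi}$. Then the following are equivalent: (i) $\varphi$ is dependent; (ii) there are $N,K,r<\omega$ and $L$-formulas $\psi_\ell(\bar y;\bar z_0,\dots,\bar z_K)$ for $\ell<r$ (without parameters) such that, for all finite nonempty partial orders $(P;\unlhd)$, all $\Delta_{N,\varphi}$-indiscernible sequences $\langle\bar b_i:i\in P\rangle$, and all $p\in S_\varphi(\{\bar b_i:i\in P\})$, there are $\ell<r$ and $i_0,\dots,i_K\in P$ (not necessarily distinct) such that, for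 all $j\in P$, \[ \varphi(\bar x;\bar b_j)\in p \iff \mathfrak{C}\models\psi_\ell(\bar b_j;\bar b_{i_0},\dots,\bar b_{i_K}). \] -/

import Mathlib

namespace POIndisc

open FirstOrder FirstOrder.Language

universe u v w

variable {L : FirstOrder.Language.{u, v}} {M : Type w} [L.Structure M] {α β : Type}

/-- `θ ^ t`: the formula `θ` itself for `t = 1` (`true`) and its negation for `t = 0` (`false`). -/
def signed {L' : FirstOrder.Language} {γ : Type} (θ : L'.Formula γ) (t : Bool) : L'.Formula γ :=
  if t then θ else θ.not

/-- The instance `φ(x; b)` of the partitioned formula `φ(x; y)`: a formula in the variables `x`,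
with the elements of the tuple `b` of `M` as constants. -/
def inst (φ : L.Formula (α ⊕ β)) (b : β → M) : L[[M]].Formula α :=
  BoundedFormula.constantsVarsEquiv.symm
    (φ.relabel (Sum.elim (fun a => Sum.inr a) (fun y => Sum.inl (b y))) : L.Formula (M ⊕ α))

/-- A set of formulas in the variables `x` with parameters from `M` is consistent (with the
elementary diagram of `M`), in the form of finite satisfiability in `M`. -/
def Consistent (p : Set (L[[M]].Formula α)) : Prop :=
  ∀ F : Set (L[[M]].Formula α), F ⊆ p → F.Finite → ∃ a : α → M, ∀ θ ∈ F, θ.Realize a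

/-- The set `B` of `y`-tuples is `φ`-independent: every choice of signs `s : B → 2` gives a
consistent set `{φ(x; b) ^ s(b) : b ∈ B}`. -/
def Independent (φ : L.Formula (α ⊕ β)) (B : Set (β → M)) : Prop :=
  ∀ s : B → Bool, Consistent (Set.range fun b : B => signed (inst φ (b : β → M)) (s b))

variable (M) in
/-- `φ` has independence dimension `N` in `M`: `N` is the maximal size of a `φ`-independent set. -/
def HasIndependenceDimension (φ : L.Formula (α ⊕ β)) (N : ℕ) : Prop :=
  IsGreatest {k : ℕ | ∃ B : Finset (β → M), B.card = k ∧ Independent φ (B : Set (β → M))} N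

variable (M) in
/-- `φ` is dependent (NIP): it has independence dimension `N` for some natural number `N`. -/
def Dependent (φ : L.Formula (α ⊕ β)) : Prop :=
  ∃ N : ℕ, HasIndependenceDimension M φ N

/-- `S_φ(B)`: the set of `φ`-types with domain `B`, i.e. of the consistent sets of formulas of the
form `φ(x; b) ^ t`, where `b` ranges over all of `B`. -/
def phiTypes (φ : L.Formula (α ⊕ β)) (B : Set (β → M)) : Set (Set (L[[M]].Formula α)) :=
  {p | (∀ θ ∈ p, ∃ b ∈ B, ∃ t : Bool, θ = signed (inst φ b) t) ∧
    (∀ b ∈ B, ∃ t : Bool, signed (inst φ b) t ∈ p) ∧ Consistent p}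

/-- The formula `∃ x, ⋀_{i ≤ n} φ(x; z_i) ^ s(i)`; the variable `(i, y)` is the `y`-th entry of the
tuple of variables `z_i`. -/
noncomputable def deltaFormula [Finite α] (φ : L.Formula (α ⊕ β)) (n : ℕ)
    (s : Fin (n + 1) → Bool) : L.Formula (Fin (n + 1) × β) :=
  Formula.iExs α (Formula.iInf fun i : Fin (n + 1) =>
    signed (φ.relabel (Sum.elim (fun a => Sum.inr a) (fun y => Sum.inl (i, y))) :
      L.Formula ((Fin (n + 1) × β) ⊕ α)) (s i))

/-- The finite set of formulas `Δ_{n,φ}(z_0, …, z_n)`. -/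
def Delta [Finite α] (φ : L.Formula (α ⊕ β)) (n : ℕ) : Set (L.Formula (Fin (n + 1) × β)) :=
  Set.range (deltaFormula φ n)

/-- `tp_Δ(c_0, …, c_n)`, as the set of the formulas of `Δ` that hold of `(c_0, …, c_n)`. -/
def tpDelta {n : ℕ} (Δ : Set (L.Formula (Fin (n + 1) × β))) (c : Fin (n + 1) → β → M) :
    Set (L.Formula (Fin (n + 1) × β)) :=
  {δ | δ ∈ Δ ∧ δ.Realize fun v => c v.1 v.2}

/-- The sequence `⟨b_i : i ∈ P⟩` is `Δ`-indiscernible with respect to the partial order `P`: any two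
`(n + 1)`-tuples of distinct indices with the same quantifier-free type in the language `{≤}`
give tuples with the same `Δ`-type. -/
def Indiscernible {n : ℕ} (Δ : Set (L.Formula (Fin (n + 1) × β))) {P : Type} [PartialOrder P]
    (b : P → β → M) : Prop :=
  ∀ i j : Fin (n + 1) → P, Function.Injective i → Function.Injective j →
    (∀ k l, i k ≤ i l ↔ j k ≤ j l) →
    tpDelta Δ (fun k => b (i k)) = tpDelta Δ (fun k => b (j k))

end POIndisc

/-! Everything is read through shattering: a finite set of parameters is `φ`-independent exactly
when the sets `φ(a; ·)` shatter it.

If `φ` is dependent, the `φ`-types over a finite set of parameters form a set family of bounded VC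
dimension, and they are defined uniformly by the Moran–Yehudayoff compression argument. Every
subfamily has a member pinned down by boundedly many points (`exists_isolated`). Applied to the
members that agree with a given `A` on an ε-approximation (`exists_approximation`), this gives, for
every probability vector, an isolated member close to `A`. Minimax (`exists_mixed_strategy`) turns
these into one distribution on isolated members that is right about each point with probability at
least 2/3, and an approximation for the dual family replaces the distribution by a majority vote of
fixed size (`exists_majority`). Membership in an isolated set says that a bounded partial `φ`-type
implies `φ(x; y)`, so the vote is first order, with one formula per pattern of signs.

Conversely, a `φ`-independent set is indiscernible for any order on its indices, while `r` formulas
with `K + 1` parameters define only polynomially many of its exponentially many subsets. -/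

namespace VC

open Finset

/-! ### Shattering -/

/-- The relation `R`, read as a family of subsets of `X` indexed by `Y`, shatters some `k` points
of `X`. -/
def ShattersSize {X Y : Type*} (R : Y → X → Prop) (k : ℕ) : Prop :=
  ∃ x : Fin k → X, ∀ S : Finset (Fin k), ∃ y, ∀ i, R y (x i) ↔ i ∈ S

theorem ShattersSize.injective {X Y : Type*} {R : Y → X → Prop} {k : ℕ} {x : Fin k → X}
    (hx : ∀ S : Finset (Fin k), ∃ y, ∀ i, R y (x i) ↔ i ∈ S) : Function.Injective x := by
  intro i j hij
  obtain ⟨y, hy⟩ := hx {i}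
  have := (hy j).1 (hij ▸ (hy i).2 (mem_singleton_self i))
  exact (mem_singleton.1 this).symm

theorem ShattersSize.mono {X Y : Type*} {R : Y → X → Prop} {k l : ℕ} (h : ShattersSize R l)
    (hkl : k ≤ l) : ShattersSize R k := by
  obtain ⟨x, hx⟩ := h
  refine ⟨fun i => x (Fin.castLE hkl i), fun S => ?_⟩
  obtain ⟨y, hy⟩ := hx (S.map (Fin.castLEEmb hkl))
  exact ⟨y, fun i => by simp [hy]⟩

theorem ShattersSize.of_comp {X X' Y : Type*} {R : Y → X → Prop} {k : ℕ} (f : X' → X)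
    (h : ShattersSize (fun y x' => R y (f x')) k) : ShattersSize R k := by
  obtain ⟨x, hx⟩ := h
  exact ⟨fun i => f (x i), hx⟩

/-- Replacing each set by its symmetric difference with a fixed set preserves shattering. -/
theorem ShattersSize.of_iff {X Y : Type*} {R : Y → X → Prop} {k : ℕ} (A : X → Prop)
    (h : ShattersSize (fun y x => (R y x ↔ A x)) k) : ShattersSize R k := by
  classical
  obtain ⟨x, hx⟩ := h
  refine ⟨x, fun S => ?_⟩
  obtain ⟨y, hy⟩ := hx (univ.filter fun i => (i ∈ S ↔ A (x i)))
  refine ⟨y, fun i => ?_⟩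
  have := hy i
  simp only [mem_filter, mem_univ, true_and] at this
  tauto

theorem ShattersSize.of_not {X Y : Type*} {R : Y → X → Prop} {k : ℕ}
    (h : ShattersSize (fun y x => ¬ R y x) k) : ShattersSize R k := by
  refine ShattersSize.of_iff (fun _ => False) ?_
  simpa using h

/-- If the dual family shatters `2 ^ k` points, then the family shatters `k` points. -/
theorem ShattersSize.of_dual {X Y : Type*} {R : Y → X → Prop} {k : ℕ}
    (h : ShattersSize (fun x y => R y x) (2 ^ k)) : ShattersSize R k := by
  classical
  obtain ⟨g, hg⟩ := h
  have e : Finset (Fin k) ≃ Fin (2 ^ k) := Fintype.equivFinOfCardEq (by simp)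
  -- The `2 ^ k` dual points are indexed by the subsets of `Fin k`; `x i` realises the dual trace
  -- "the subset contains `i`", so the point indexed by `S` cuts out exactly `S`.
  choose x hx using fun i : Fin k => hg (univ.filter fun t => i ∈ e.symm t)
  refine ⟨x, fun S => ⟨g (e S), fun i => ?_⟩⟩
  simp [hx i (e S)]

/-! ### Isolated members of families of bounded dimension -/

/-- In a nonempty finite family that shatters no `d + 1` points, some member is determined within
the family by its trace on a set whose size is bounded in terms of `d`. -/
theorem exists_isolated (d : ℕ) : ∃ k : ℕ, ∀ (X : Type) [Fintype X] [DecidableEq X]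
    (Q : Finset (Finset X)), Q.Nonempty →
    ¬ ShattersSize (fun (q : {q // q ∈ Q}) x => x ∈ q.1) (d + 1) →
    ∃ q ∈ Q, ∃ S : Finset X, #S ≤ k ∧ ∀ q' ∈ Q, (∀ x ∈ S, x ∈ q' ↔ x ∈ q) → q' = q := by
  induction d with
  | zero =>
    refine ⟨0, fun X _ _ Q ⟨q, hq⟩ hsh => ⟨q, hq, ∅, by simp, fun q' hq' _ => ?_⟩⟩
    by_contra hne
    apply hsh
    obtain ⟨x, hx⟩ : ∃ x, ¬ (x ∈ q' ↔ x ∈ q) := by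
      by_contra! h
      exact hne (Finset.ext h)
    refine ⟨fun _ => x, fun S => ?_⟩
    by_cases h : (x ∈ q ↔ (0 : Fin 1) ∈ S)
    · refine ⟨⟨q, hq⟩, fun i => ?_⟩
      rw [show i = 0 from Fin.ext (by omega)]
      exact h
    · refine ⟨⟨q', hq'⟩, fun i => ?_⟩
      rw [show i = 0 from Fin.ext (by omega)]
      change x ∈ q' ↔ _
      tauto
  | succ d ih =>
    obtain ⟨k, hk⟩ := ih
    -- Large enough that among `k₀` points labelled by the `2 ^ (d + 1)` traces on a set of `d + 1`
    -- points, some `d + 1` share a label.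
    set k₀ := 2 ^ (d + 1) * d + 1 with hk₀
    refine ⟨k₀ + k, fun X _ _ Q hQ hsh => ?_⟩
    by_cases hX : Fintype.card X < k₀
    · obtain ⟨q, hq⟩ := hQ
      refine ⟨q, hq, univ, by rw [card_univ]; omega, fun q' _ h => Finset.ext fun x => ?_⟩
      exact h x (mem_univ x)
    push Not at hX
    let sub : Finset X → Finset X → Finset (Finset X) :=
      fun Y c => Q.filter fun q => ∀ x ∈ Y, x ∈ q ↔ x ∈ c
    -- Fix the trace on `k₀` points so that as few members as possible survive. By minimality the
    -- surviving family has smaller dimension, and induction applies to it.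
    obtain ⟨⟨Y, c⟩, hYc, hmin⟩ := exists_min_image
      ((powersetCard k₀ (univ : Finset X)) ×ˢ Q) (fun p => #(sub p.1 p.2))
      ((powersetCard_nonempty.2 (by rwa [card_univ])).product hQ)
    simp only [mem_product, mem_powersetCard, subset_univ, true_and] at hYc hmin
    obtain ⟨hY, hc⟩ := hYc
    have key : ¬ ShattersSize (fun (q : {q // q ∈ sub Y c}) x => x ∈ q.1) (d + 1) := by
      rintro ⟨Z, hZ⟩
      have hZ' : ∀ T : Finset (Fin (d + 1)), ∃ q ∈ Q, (∀ x ∈ Y, x ∈ q ↔ x ∈ c) ∧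
          ∀ i, Z i ∈ q ↔ i ∈ T := by
        intro T
        obtain ⟨⟨q, hq⟩, h⟩ := hZ T
        rw [mem_filter] at hq
        exact ⟨q, hq.1, hq.2, h⟩
      -- Some trace on `Z` forces the value at `w`: otherwise `w` and `Z` together would be
      -- shattered, the value of `c` at `w` coming from the surviving members and the opposite value
      -- from the others.
      have h1 : ∀ w ∈ Y, ∃ T : Finset (Fin (d + 1)),
          ∀ q ∈ Q, (∀ i, Z i ∈ q ↔ i ∈ T) → (w ∈ q ↔ w ∈ c) := by
        intro w hw
        by_contra! hcon
        apply hsh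
        refine ⟨Fin.cons w Z, fun S => ?_⟩
        set T : Finset (Fin (d + 1)) := univ.filter fun i => i.succ ∈ S with hT
        by_cases hS : (w ∈ c ↔ (0 : Fin (d + 2)) ∈ S)
        · obtain ⟨q, hq, hqY, hqT⟩ := hZ' T
          refine ⟨⟨q, hq⟩, fun i => ?_⟩
          refine Fin.cases ?_ (fun i => ?_) i
          · exact (hqY w hw).trans hS
          · simpa [hT] using hqT i
        · obtain ⟨q, hq, hqT, hqw⟩ := hcon T
          refine ⟨⟨q, hq⟩, fun i => ?_⟩
          refine Fin.cases ?_ (fun i => ?_) i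
          · change w ∈ q ↔ _
            tauto
          · simpa [hT] using hqT i
      choose! T hT using h1
      obtain ⟨T₀, -, hT₀⟩ := exists_lt_card_fiber_of_mul_lt_card_of_maps_to
        (s := Y) (t := univ) (f := T) (n := d) (fun _ _ => mem_univ _)
        (by rw [hY, card_univ, Fintype.card_finset, Fintype.card_fin]; omega)
      obtain ⟨W, hWsub, hW⟩ := exists_subset_card_eq (n := d + 1) hT₀
      have hWY : W ⊆ Y := hWsub.trans (filter_subset _ _)
      obtain ⟨q₀, hq₀, hq₀Y, hq₀T⟩ := hZ' T₀
      -- Trade `W` for `Z` with the trace `T₀`, which forces the values on `W`. The new restriction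
      -- implies the old one and is strictly stronger, since `Z` is shattered by the survivors.
      obtain ⟨Y', hY'sub, hY'⟩ : ∃ Y' : Finset X, (Y \ W) ∪ univ.image Z ⊆ Y' ∧ #Y' = k₀ := by
        have h2 : #((Y \ W) ∪ univ.image Z) ≤ k₀ := by
          refine (card_union_le _ _).trans ?_
          rw [card_sdiff_of_subset hWY, hY, hW]
          have h3 : #(univ.image Z) ≤ d + 1 := card_image_le.trans (by simp)
          have h4 : d + 1 ≤ k₀ := by
            rw [← hY, ← hW]
            exact card_le_card hWY

          omega
        obtain ⟨Y', h, -, h'⟩ := exists_subsuperset_card_eq (subset_univ _) h2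
          (by rwa [card_univ])
        exact ⟨Y', h, h'⟩
      have hle := hmin (Y', q₀) ⟨hY', hq₀⟩
      refine absurd hle (not_le.2 (card_lt_card ?_))
      rw [ssubset_iff_of_subset]
      · obtain ⟨q₁, hq₁, hq₁Y, hq₁T⟩ := hZ' T₀ᶜ
        refine ⟨q₁, mem_filter.2 ⟨hq₁, hq₁Y⟩, fun h => ?_⟩
        have h5 := (mem_filter.1 h).2 (Z 0) (hY'sub (mem_union_right _ (by simp)))
        rw [hq₁T, hq₀T, mem_compl] at h5
        tauto
      · intro q hq
        obtain ⟨hqQ, hqY⟩ := mem_filter.1 hq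
        refine mem_filter.2 ⟨hqQ, fun x hx => ?_⟩
        by_cases hxW : x ∈ W
        · obtain ⟨-, hxT⟩ := mem_filter.1 (hWsub hxW)
          refine hT x hx q hqQ fun i => ?_
          rw [hqY (Z i) (hY'sub (mem_union_right _ (by simp))), hq₀T, hxT]
        · rw [hqY x (hY'sub (mem_union_left _ (by simp [hx, hxW]))), hq₀Y x hx]
    obtain ⟨q, hq, S, hS, hiso⟩ := hk X (sub Y c) ⟨c, mem_filter.2 ⟨hc, by simp⟩⟩ key
    obtain ⟨hqQ, hqY⟩ := mem_filter.1 hq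
    refine ⟨q, hqQ, Y ∪ S, (card_union_le _ _).trans (by omega), fun q' hq' h => ?_⟩
    refine hiso q' (mem_filter.2 ⟨hq', fun x hx => ?_⟩) fun x hx => h x (mem_union_right _ hx)
    rw [h x (mem_union_left _ hx), hqY x hx]

/-! ### Approximation of measures by bounded samples -/

/-- The Sauer–Shelah bound on the number of traces. -/
theorem card_traces_le {X Y : Type*} [Fintype X] [DecidableEq X] {R : Y → X → Prop} {d : ℕ}
    (hR : ¬ ShattersSize R d) (𝒜 : Finset (Finset X))
    (h𝒜 : ∀ F ∈ 𝒜, ∃ y, ∀ x, x ∈ F ↔ R y x) : #𝒜 ≤ (Fintype.card X + 1) ^ d := by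
  have hdim : 𝒜.vcDim ≤ d := by
    refine Finset.sup_le fun s hs => ?_
    rw [mem_shatterer] at hs
    by_contra! hlt
    refine hR (ShattersSize.mono ⟨fun i => (s.equivFin.symm i : X), fun S => ?_⟩ hlt.le)
    obtain ⟨u, hu, hsu⟩ := hs (t := S.image fun i => (s.equivFin.symm i : X)) (by
      intro x hx
      obtain ⟨i, -, rfl⟩ := mem_image.1 hx
      exact (s.equivFin.symm i).2)
    obtain ⟨y, hy⟩ := h𝒜 u hu
    refine ⟨y, fun i => ?_⟩
    rw [← hy]
    have h1 : (s.equivFin.symm i : X) ∈ s ∩ u ↔ (s.equivFin.symm i : X) ∈ u := by simp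
    rw [← h1, hsu, mem_image]
    constructor
    · rintro ⟨j, hj, hij⟩
      rwa [← s.equivFin.symm.injective (Subtype.ext hij)]
    · exact fun hi => ⟨i, hi, rfl⟩
  refine (card_le_card_shatterer 𝒜).trans (card_shatterer_le_sum_vcDim.trans ?_)
  calc ∑ k ∈ Iic 𝒜.vcDim, (Fintype.card X).choose k
      ≤ ∑ k ∈ range (d + 1), (Fintype.card X).choose k := by
        refine sum_le_sum_of_subset fun k hk => ?_
        rw [mem_Iic] at hk
        rw [mem_range]
        omega
    _ ≤ ∑ k ∈ range (d + 1), Fintype.card X ^ k * 1 ^ (d - k) * d.choose k := by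
        refine sum_le_sum fun k hk => ?_
        rw [mem_range] at hk
        rw [one_pow, mul_one]
        exact (Nat.choose_le_pow _ _).trans
          (Nat.le_mul_of_pos_right _ (Nat.choose_pos (by omega)))
    _ = (Fintype.card X + 1) ^ d := (add_pow _ _ _).symm

/-- A Hoeffding bound for sums with random signs. -/
theorem card_signs_le {n : ℕ} (u : Fin n → ℝ) (hu : ∀ i, |u i| ≤ 1) {δ : ℝ} (hδ : 0 ≤ δ) :
    (#{σ : Fin n → Bool | ∑ i, (if σ i then u i else - u i) < -(δ * n)} : ℝ) ≤
      2 ^ n * Real.exp (-(n * δ ^ 2 / 2)) := by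
  -- Chernoff's method with exponent `-δ`: the exponential moment factors over the signs, and `cosh
  -- x ≤ exp (x ^ 2 / 2)`. Markov's inequality follows in `h2`.
  have h1 : ∑ σ : Fin n → Bool, Real.exp (-δ * ∑ i, (if σ i then u i else - u i)) ≤
      2 ^ n * Real.exp (n * δ ^ 2 / 2) := by
    calc ∑ σ : Fin n → Bool, Real.exp (-δ * ∑ i, (if σ i then u i else - u i))
        = ∑ σ : Fin n → Bool, ∏ i, Real.exp (-δ * (if σ i then u i else - u i)) := by
          simp_rw [mul_sum, Real.exp_sum]
      _ = ∏ i, ∑ b : Bool, Real.exp (-δ * (if b then u i else - u i)) := by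
          rw [prod_univ_sum, Fintype.piFinset_univ]
      _ = ∏ i, 2 * Real.cosh (δ * u i) := by
          refine prod_congr rfl fun i _ => ?_
          rw [Fintype.sum_bool, Real.cosh_eq]
          simp only [if_true, Bool.false_eq_true, if_false, neg_mul, mul_neg, neg_neg]
          ring
      _ ≤ ∏ _i : Fin n, 2 * Real.exp (δ ^ 2 / 2) := by
          refine prod_le_prod (fun i _ => by positivity) fun i _ => ?_
          refine mul_le_mul_of_nonneg_left ((Real.cosh_le_exp_half_sq _).trans ?_) zero_le_two
          rw [Real.exp_le_exp, mul_pow]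
          have : u i ^ 2 ≤ 1 := (sq_le_one_iff_abs_le_one _).2 (hu i)
          nlinarith [sq_nonneg δ]
      _ = 2 ^ n * Real.exp (n * δ ^ 2 / 2) := by
          rw [prod_const, card_univ, Fintype.card_fin, mul_pow, ← Real.exp_nat_mul]
          ring_nf
  have h2 : (#{σ : Fin n → Bool | ∑ i, (if σ i then u i else - u i) < -(δ * n)} : ℝ) *
      Real.exp (n * δ ^ 2) ≤
      ∑ σ : Fin n → Bool, Real.exp (-δ * ∑ i, (if σ i then u i else - u i)) := by
    rw [← nsmul_eq_mul]
    refine (card_nsmul_le_sum _ _ _ fun σ hσ => ?_).trans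
      (sum_le_sum_of_subset_of_nonneg (subset_univ _) fun _ _ _ => (Real.exp_pos _).le)
    rw [Real.exp_le_exp]
    nlinarith [(mem_filter.1 hσ).2]
  have h3 : Real.exp (n * δ ^ 2 / 2) = Real.exp (-(n * δ ^ 2 / 2)) * Real.exp (n * δ ^ 2) := by
    rw [← Real.exp_add]
    ring_nf
  refine le_of_mul_le_mul_right ?_ (Real.exp_pos (n * δ ^ 2))
  rw [mul_assoc, ← h3]
  exact h2.trans h1

open Classical in
/-- From `n` pairs of points one can select one point of each pair so that every set of the family
contains nearly half of the points it had before. -/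
theorem exists_halving {Y : Type*} {d n : ℕ} {δ : ℝ} (hδ : 0 ≤ δ) {R : Y → Fin n × Bool → Prop}
    (hR : ¬ ShattersSize R d)
    (h : (2 * n + 1 : ℝ) ^ d * Real.exp (-(n * δ ^ 2 / 2)) < 1) :
    ∃ σ : Fin n → Bool, ∀ y,
      ((#{p | R y p} : ℝ) - δ * n) / 2 ≤ #{i | R y (i, σ i)} := by
  set 𝒜 : Finset (Finset (Fin n × Bool)) :=
    univ.filter fun F => ∃ y, ∀ p, p ∈ F ↔ R y p with h𝒜
  have hcard : (#𝒜 : ℝ) ≤ (2 * n + 1 : ℝ) ^ d := by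
    have := card_traces_le hR 𝒜 fun F hF => (mem_filter.1 hF).2
    rw [Fintype.card_prod, Fintype.card_fin, Fintype.card_bool, mul_comm] at this
    exact_mod_cast this
  let ind : Finset (Fin n × Bool) → Fin n × Bool → ℝ := fun F p => if p ∈ F then 1 else 0
  -- The signed sum is twice the number of selected points of `F` minus `#F`, so `bad F` collects
  -- the selections that miss half of `F` by more than `δ * n / 2`. A union bound over the traces
  -- leaves a good selection.
  let bad : Finset (Fin n × Bool) → Finset (Fin n → Bool) := fun F =>
    {σ | ∑ i, (if σ i then ind F (i, true) - ind F (i, false)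
      else -(ind F (i, true) - ind F (i, false))) < -(δ * n)}
  have hbad : ∀ F, (#(bad F) : ℝ) ≤ 2 ^ n * Real.exp (-(n * δ ^ 2 / 2)) := fun F => by
    refine card_signs_le _ (fun i => ?_) hδ
    simp only [ind]
    split_ifs <;> simp
  obtain ⟨σ, hσ⟩ : ∃ σ, σ ∉ 𝒜.biUnion bad := by
    by_contra! hall
    have h1 : (2 : ℝ) ^ n ≤ #𝒜 * (2 ^ n * Real.exp (-(n * δ ^ 2 / 2))) := by
      calc (2 : ℝ) ^ n = #(univ : Finset (Fin n → Bool)) := by simp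
        _ ≤ #(𝒜.biUnion bad) := by
          rw [eq_univ_of_forall hall]
        _ ≤ ∑ F ∈ 𝒜, (#(bad F) : ℝ) := by exact_mod_cast card_biUnion_le
        _ ≤ #𝒜 * (2 ^ n * Real.exp (-(n * δ ^ 2 / 2))) := by
          rw [← nsmul_eq_mul]
          exact sum_le_card_nsmul _ _ _ fun F _ => hbad F
    have h2 : (#𝒜 : ℝ) * Real.exp (-(n * δ ^ 2 / 2)) < 1 :=
      (mul_le_mul_of_nonneg_right hcard (Real.exp_pos _).le).trans_lt h
    have h3 : (0 : ℝ) < 2 ^ n := by positivity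
    nlinarith
  refine ⟨σ, fun y => ?_⟩
  set F : Finset (Fin n × Bool) := {p | R y p} with hF
  have hF𝒜 : F ∈ 𝒜 := mem_filter.2 ⟨mem_univ _, y, fun p => by simp [hF]⟩
  have hσF : σ ∉ bad F := fun hb => hσ (mem_biUnion.2 ⟨F, hF𝒜, hb⟩)
  simp only [bad, mem_filter, mem_univ, true_and, not_lt] at hσF
  have h1 : (#F : ℝ) = ∑ i, (ind F (i, true) + ind F (i, false)) := by
    simp only [ind]
    have : (#F : ℝ) = ∑ p, if p ∈ F then (1 : ℝ) else 0 := by simp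
    rw [this, Fintype.sum_prod_type]
    simp only [Fintype.sum_bool]
  have h2 : (#{i | R y (i, σ i)} : ℝ) = ∑ i, ind F (i, σ i) := by
    simp [ind, hF]
  have h3 : ∑ i, (if σ i then ind F (i, true) - ind F (i, false)
      else -(ind F (i, true) - ind F (i, false))) =
      2 * ∑ i, ind F (i, σ i) - ∑ i, (ind F (i, true) + ind F (i, false)) := by
    rw [mul_sum, ← sum_sub_distrib]
    refine sum_congr rfl fun i _ => ?_
    cases σ i <;> simp <;> ring
  rw [h3] at hσF
  rw [h1, h2]
  linarith

/-- For `δ = n ^ (-1/4)` the exponent is `x = √n / 2`, and `2 * n + 1 = 8 * x ^ 2 + 1 ≤ 9 * x ^ 2`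
once `x ≥ 1`, so the exponential beats the polynomial. This makes `exists_halving` applicable with
an error tending to zero. -/
theorem eventually_growth_lt (d : ℕ) : ∃ n₁ : ℕ, ∀ n : ℕ, n₁ ≤ n →
    (2 * n + 1 : ℝ) ^ d * Real.exp (-(n * (√(√n))⁻¹ ^ 2 / 2)) < 1 := by
  have h1 : Filter.Tendsto (fun x : ℝ => 9 ^ d * (x ^ (2 * d) * Real.exp (-x)))
      Filter.atTop (nhds 0) := by
    simpa using (Real.tendsto_pow_mul_exp_neg_atTop_nhds_zero (2 * d)).const_mul (9 ^ d)
  have h2 : Filter.Tendsto (fun n : ℕ => √(n : ℝ) / 2) Filter.atTop Filter.atTop :=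
    (Real.tendsto_sqrt_atTop.comp tendsto_natCast_atTop_atTop).atTop_div_const zero_lt_two
  obtain ⟨n₁, hn₁⟩ := Filter.eventually_atTop.1
    (((h1.comp h2).eventually (gt_mem_nhds zero_lt_one)).and (h2.eventually_ge_atTop 1))
  refine ⟨n₁, fun n hn => ?_⟩
  obtain ⟨h3, h4⟩ := hn₁ n hn
  simp only [Function.comp_apply] at h3
  set x := √(n : ℝ) / 2 with hx
  have hs : √(n : ℝ) = 2 * x := by rw [hx]; ring
  have hn' : (n : ℝ) = (2 * x) ^ 2 := by rw [← hs, Real.sq_sqrt (Nat.cast_nonneg n)]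
  have h5 : (n : ℝ) * (√(√n))⁻¹ ^ 2 / 2 = x := by
    rw [inv_pow, Real.sq_sqrt (Real.sqrt_nonneg _), hs, hn']
    field_simp
  rw [h5]
  refine lt_of_le_of_lt ?_ h3
  rw [← mul_assoc, pow_mul, ← mul_pow]
  refine mul_le_mul_of_nonneg_right (pow_le_pow_left₀ (by positivity) ?_ d) (Real.exp_pos _).le
  rw [hn']
  nlinarith

open Classical in
/-- Repeated halving: a uniform sample of size `n * 2 ^ k` can be replaced by one of size `n`. -/
theorem exists_subsample (d : ℕ) : ∃ n₁ : ℕ, 0 < n₁ ∧ ∀ (k n : ℕ), n₁ ≤ n → ∀ (ι Y : Type)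
    [Fintype ι] (R : Y → ι → Prop), Fintype.card ι = n * 2 ^ k → ¬ ShattersSize R d →
    ∃ x : Fin n → ι, ∀ y, (#{p | R y p} : ℝ) / (n * 2 ^ k) - 7 * (√(√n))⁻¹ ≤
      (#{i | R y (x i)} : ℝ) / n := by
  obtain ⟨n₁, hn₁⟩ := eventually_growth_lt d
  refine ⟨n₁ + 1, by omega, fun k => ?_⟩
  induction k with
  | zero =>
    intro n hn ι Y _ R hcard _
    let e : Fin n ≃ ι := (Fintype.equivFinOfCardEq (by simpa using hcard)).symm
    refine ⟨e, fun y => ?_⟩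
    have h1 : #{i | R y (e i)} = #{p | R y p} := card_equiv e (by simp)
    rw [h1, pow_zero, mul_one]
    have : 0 ≤ 7 * (√(√(n : ℝ)))⁻¹ := by positivity
    linarith
  | succ k ih =>
    intro n hn ι Y _ R hcard hR
    obtain ⟨x, hx⟩ := ih (2 * n) (by omega) ι Y R (by rw [hcard]; ring) hR
    let e : Fin n × Bool ≃ Fin (2 * n) := Fintype.equivOfCardEq (by simp [mul_comm])
    obtain ⟨σ, hσ⟩ := exists_halving (R := fun y p => R y (x (e p))) (δ := (√(√n))⁻¹)
      (by positivity) (fun h => hR (h.of_comp fun p => x (e p))) (hn₁ n (by omega))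
    refine ⟨fun i => x (e (i, σ i)), fun y => ?_⟩
    have h1 : #{p | R y (x (e p))} = #{i | R y (x i)} := card_equiv e (by simp)
    have h2 := hσ y
    have h3 := hx y
    rw [h1] at h2
    have hn0 : (0 : ℝ) < n := by exact_mod_cast (by omega : 0 < n)
    have hq : 0 < √(√(n : ℝ)) := by positivity
    -- The constant 7 survives the induction: `2 ^ (-1/4) < 0.85`, and `7 * 0.85 + 1/2 ≤ 7`, where
    -- `1/2` is the loss of the last halving.
    have h4 : (√(√((2 * n : ℕ) : ℝ)))⁻¹ ≤ 0.85 * (√(√(n : ℝ)))⁻¹ := by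
      have h5 : (0.85 : ℝ)⁻¹ ≤ √(√2) := by
        refine Real.le_sqrt_of_sq_le (Real.le_sqrt_of_sq_le ?_)
        norm_num
      push_cast
      rw [Real.sqrt_mul zero_le_two, Real.sqrt_mul (Real.sqrt_nonneg _), mul_inv]
      refine mul_le_mul_of_nonneg_right ?_ (by positivity)
      exact inv_le_of_inv_le₀ (by norm_num) h5
    set a : ℝ := Nat.cast (#{i | R y (x i)})
    set b : ℝ := Nat.cast (#{i | R y (x (e (i, σ i)))})
    set t : ℝ := Nat.cast (#{p | R y p})
    set δ := (√(√(n : ℝ)))⁻¹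
    have h6 : t / (n * 2 ^ (k + 1)) = t / ((2 * n : ℕ) * 2 ^ k) := by
      push_cast
      ring_nf
    have h7 : a / (2 * n) - δ / 2 ≤ b / n := by
      rw [le_div_iff₀ hn0]
      have : (a / (2 * n) - δ / 2) * n = (a - δ * n) / 2 := by
        field_simp
      rw [this]
      exact h2
    rw [h6]
    have hδ : 0 ≤ δ := by positivity
    push_cast at h3 ⊢
    push_cast at h4
    linarith

open Classical in
/-- Approximation of a probability vector by a uniform sample. -/
theorem exists_sample_fiber {X : Type*} [Fintype X] {μ : X → ℝ} (hμ : μ ∈ stdSimplex ℝ X)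
    (N : ℕ) : ∃ x : Fin N → X, ∀ a, N * μ a - 1 ≤ (#{i | x i = a} : ℝ) := by
  have hne : Nonempty X := by
    by_contra h
    rw [not_nonempty_iff] at h
    simpa using hμ.2
  have hle : Fintype.card (Σ a : X, Fin ⌊N * μ a⌋₊) ≤ Fintype.card (Fin N) := by
    rw [Fintype.card_sigma, Fintype.card_fin]
    simp only [Fintype.card_fin]
    have : (∑ a, (⌊N * μ a⌋₊ : ℝ)) ≤ N := by
      calc (∑ a, (⌊N * μ a⌋₊ : ℝ)) ≤ ∑ a, N * μ a :=
            sum_le_sum fun a _ => Nat.floor_le (mul_nonneg (Nat.cast_nonneg _) (hμ.1 a))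
        _ = N := by rw [← mul_sum, hμ.2, mul_one]
    exact_mod_cast this
  obtain ⟨f⟩ := Function.Embedding.nonempty_of_card_le hle
  -- Leftover indices are sent to an arbitrary point, since only a lower bound on the fibres is
  -- wanted.
  refine ⟨Function.extend f Sigma.fst fun _ => hne.some, fun a => ?_⟩
  have h1 : ⌊N * μ a⌋₊ ≤ #{i | Function.extend f Sigma.fst (fun _ => hne.some) i = a} := by
    calc ⌊N * μ a⌋₊ = #(univ : Finset (Fin ⌊N * μ a⌋₊)) := by simp
      _ ≤ _ := by
        refine card_le_card_of_injOn (fun k => f ⟨a, k⟩) (fun k _ => ?_) fun k _ l _ hkl => ?_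
        · simp [f.injective.extend_apply]
        · simpa using f.injective hkl
  have h2 := Nat.lt_floor_add_one (N * μ a)
  have h3 : (⌊N * μ a⌋₊ : ℝ) ≤ #{i | Function.extend f Sigma.fst (fun _ => hne.some) i = a} := by
    exact_mod_cast h1
  linarith

open Classical in
/-- One-sided `ε`-approximations: for a family that does not shatter `d` points, the measure of each
set is bounded, up to `ε`, by its frequency in a suitable sample of size depending only on `d`
and `ε`. -/
theorem exists_approximation (d : ℕ) {ε : ℝ} (hε : 0 < ε) : ∃ n : ℕ, 0 < n ∧ ∀ (X Y : Type)
    [Fintype X] (R : Y → X → Prop), ¬ ShattersSize R d → ∀ μ ∈ stdSimplex ℝ X,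
    ∃ x : Fin n → X, ∀ y, (∑ a with R y a, μ a) - ε ≤ (#{i | R y (x i)} : ℝ) / n := by
  obtain ⟨n₁, hn₁, H⟩ := exists_subsample d
  have ht : Filter.Tendsto (fun n : ℕ => 7 * (√(√(n : ℝ)))⁻¹) Filter.atTop (nhds 0) := by
    have := (Real.tendsto_sqrt_atTop.comp
      (Real.tendsto_sqrt_atTop.comp tendsto_natCast_atTop_atTop)).inv_tendsto_atTop.const_mul 7
    simpa using this
  obtain ⟨n, hn, hnε⟩ := ((Filter.eventually_ge_atTop n₁).and
    (ht.eventually (gt_mem_nhds (half_pos hε)))).exists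
  have hn0 : 0 < n := by omega
  refine ⟨n, hn0, fun X Y _ R hR μ hμ => ?_⟩
  have hn0' : (0 : ℝ) < n := by exact_mod_cast hn0
  -- Rounding `μ` costs at most `1 / (n * 2 ^ k)` per point of `X`. The power `k` may depend on `X`,
  -- because the final sample size `n` and the loss from halving do not depend on `k`.
  obtain ⟨k, hk⟩ : ∃ k : ℕ, (Fintype.card X : ℝ) / (n * 2 ^ k) ≤ ε / 2 := by
    obtain ⟨k, hk⟩ := pow_unbounded_of_one_lt ((Fintype.card X : ℝ) / (ε / 2)) one_lt_two
    refine ⟨k, ?_⟩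
    rw [div_le_iff₀ (by positivity)]
    rw [div_lt_iff₀ (by positivity)] at hk
    have h1 : (1 : ℝ) ≤ n := by exact_mod_cast hn0
    have h2 : (0 : ℝ) < 2 ^ k * (ε / 2) := by positivity
    nlinarith
  obtain ⟨x₀, hx₀⟩ := exists_sample_fiber hμ (n * 2 ^ k)
  obtain ⟨x, hx⟩ := H k n hn (Fin (n * 2 ^ k)) Y (fun y p => R y (x₀ p)) (by simp)
    fun h => hR (h.of_comp x₀)
  refine ⟨fun i => x₀ (x i), fun y => le_trans ?_ (hx y)⟩
  have h1 : (#{p | R y (x₀ p)} : ℝ) = ∑ a with R y a, (#{p | x₀ p = a} : ℝ) := by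
    rw [card_eq_sum_card_fiberwise (f := x₀) (t := univ.filter fun a => R y a)
      (fun p hp => by simpa using hp)]
    push_cast
    refine sum_congr rfl fun a ha => ?_
    congr 2
    ext p
    simp only [mem_filter, mem_univ, true_and] at ha ⊢
    constructor
    · exact fun h => h.2
    · rintro rfl
      exact ⟨ha, rfl⟩
  have h2 : (n * 2 ^ k : ℝ) * (∑ a with R y a, μ a) - Fintype.card X ≤
      #{p | R y (x₀ p)} := by
    rw [h1]
    calc (n * 2 ^ k : ℝ) * (∑ a with R y a, μ a) - Fintype.card X
        ≤ (n * 2 ^ k : ℝ) * (∑ a with R y a, μ a) - #{a | R y a} := by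
          have : (#{a | R y a} : ℝ) ≤ Fintype.card X := by exact_mod_cast card_le_univ _
          linarith
      _ = ∑ a with R y a, ((n * 2 ^ k : ℕ) * μ a - 1) := by
          rw [sum_sub_distrib, ← mul_sum]
          push_cast
          simp
      _ ≤ _ := sum_le_sum fun a _ => hx₀ a
  have hN : (0 : ℝ) < n * 2 ^ k := by positivity
  have h3 : (∑ a with R y a, μ a) - Fintype.card X / (n * 2 ^ k) ≤
      (#{p | R y (x₀ p)} : ℝ) / (n * 2 ^ k) := by
    rw [le_div_iff₀ hN, sub_mul, div_mul_cancel₀ _ hN.ne']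
    linarith
  linarith

/-! ### Minimax -/

/-- The minimax theorem for finite zero-sum games. -/
theorem exists_mixed_strategy {H P : Type*} [Fintype H] [Fintype P] [Nonempty P]
    (M : H → P → ℝ) (c : ℝ) (h : ∀ μ ∈ stdSimplex ℝ P, ∃ q, c ≤ ∑ j, μ j * M q j) :
    ∃ ν ∈ stdSimplex ℝ H, ∀ j, c ≤ ∑ q, ν q * M q j := by
  classical
  have hH : Nonempty H := by
    obtain ⟨q, -⟩ := h _ (single_mem_stdSimplex ℝ (Classical.arbitrary P))
    exact ⟨q⟩
  let F : (H → ℝ) →ₗ[ℝ] (P → ℝ) :=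
    { toFun := fun ν j => ∑ q, ν q * M q j
      map_add' := fun ν ν' => by ext j; simp [add_mul, sum_add_distrib]
      map_smul' := fun a ν => by ext j; simp [mul_sum, mul_assoc] }
  have hF : ∀ ν j, F ν j = ∑ q, ν q * M q j := fun _ _ => rfl
  by_contra! hcon
  -- Separate the compact convex set of payoff vectors from the orthant above `c`. The coefficients
  -- of the separating functional, normalised, form an opposing mixed strategy that contradicts `h`.
  obtain ⟨f, u, v, hfu, huv, hfv⟩ := geometric_hahn_banach_compact_closed
    (s := F '' stdSimplex ℝ H) (t := Set.Ici fun _ => c)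
    ((convex_stdSimplex ℝ H).linear_image F)
    ((isCompact_stdSimplex ℝ H).image F.continuous_of_finiteDimensional)
    (convex_Ici _) isClosed_Ici (by
      rw [Set.disjoint_left]
      rintro _ ⟨ν, hν, rfl⟩ hc
      obtain ⟨j, hj⟩ := hcon ν hν
      exact absurd (hc j) (not_le.2 hj))
  set w : P → ℝ := fun j => f (Pi.single j 1) with hw
  have hfw : ∀ a : P → ℝ, f a = ∑ j, a j * w j := by
    intro a
    conv_lhs => rw [pi_eq_sum_univ' a, map_sum]
    refine sum_congr rfl fun j _ => ?_
    rw [map_smul, smul_eq_mul, hw]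
  have hsingle : ∀ q, F (Pi.single q 1) = M q := by
    intro q
    ext j
    simp [hF, Pi.single_apply]
  have hMu : ∀ q, f (M q) < u := fun q =>
    hfu _ ⟨_, single_mem_stdSimplex ℝ q, hsingle q⟩
  have hw0 : ∀ j, 0 ≤ w j := by
    intro j
    by_contra! hj
    have hc := hfv (fun _ => c) (Set.mem_Ici.2 le_rfl)
    -- With a negative coefficient, moving this far up the orthant along `j` brings `f` down to `v`.
    set s := (f (fun _ => c) - v) / (- w j)
    have hs : 0 ≤ s := div_nonneg (by linarith) (by linarith)
    have h1 := hfv ((fun _ => c) + s • Pi.single j 1) (Set.mem_Ici.2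
      (le_add_of_nonneg_right (smul_nonneg hs (Pi.single_nonneg.2 zero_le_one))))
    rw [map_add, map_smul, smul_eq_mul] at h1
    have h2 : s * (- w j) = f (fun _ => c) - v := div_mul_cancel₀ _ (by linarith)
    change v < f (fun _ => c) + s * w j at h1
    linarith
  have hW : 0 < ∑ j, w j := by
    refine lt_of_le_of_ne (sum_nonneg fun j _ => hw0 j) fun h0 => ?_
    have hz : ∀ j, w j = 0 := fun j =>
      (sum_eq_zero_iff_of_nonneg fun j _ => hw0 j).1 h0.symm j (mem_univ j)
    have hf0 : ∀ a, f a = 0 := fun a => by simp [hfw, hz]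
    have h1 := hMu (Classical.arbitrary H)
    have h2 := hfv (fun _ => c) (Set.mem_Ici.2 le_rfl)
    rw [hf0] at h1 h2
    linarith
  obtain ⟨q, hq⟩ := h (fun j => w j / ∑ j, w j)
    ⟨fun j => div_nonneg (hw0 j) hW.le, by rw [← sum_div, div_self hW.ne']⟩
  have h1 : ∑ j, w j / (∑ j, w j) * M q j = f (M q) / ∑ j, w j := by
    rw [hfw, sum_div]
    exact sum_congr rfl fun j _ => by ring
  rw [h1, le_div_iff₀ hW] at hq
  have h2 := hfv (fun _ => c) (Set.mem_Ici.2 le_rfl)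
  rw [hfw, ← mul_sum] at h2
  linarith [hMu q]

/-! ### Majority votes of isolated members -/

theorem ShattersSize.of_reindex {X Y Y' : Type*} {R : Y → X → Prop} {k : ℕ} (g : Y' → Y)
    (h : ShattersSize (fun y x => R (g y) x) k) : ShattersSize R k := by
  obtain ⟨x, hx⟩ := h
  refine ⟨x, fun S => ?_⟩
  obtain ⟨y, hy⟩ := hx S
  exact ⟨g y, hy⟩

/-- `S` determines `q` within the family `𝒜`. -/
def Isolates {X : Type*} (𝒜 : Finset (Finset X)) (S q : Finset X) : Prop :=
  ∀ q' ∈ 𝒜, (∀ x ∈ S, x ∈ q' ↔ x ∈ q) → q' = q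

open Classical in
/-- For every probability vector, each member of the family is approximated by one that is isolated
by a bounded number of points. -/
theorem exists_isolated_approximation (d : ℕ) : ∃ m : ℕ, ∀ (P : Type) [Fintype P]
    (𝒜 : Finset (Finset P)), ¬ ShattersSize (fun (q : {q // q ∈ 𝒜}) x => x ∈ q.1) (d + 1) →
    ∀ A ∈ 𝒜, ∀ μ ∈ stdSimplex ℝ P, ∃ q ∈ 𝒜, (∃ S : Finset P, #S ≤ m ∧ Isolates 𝒜 S q) ∧
      2 / 3 ≤ ∑ j, μ j * (if (j ∈ q ↔ j ∈ A) then 1 else 0) := by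
  obtain ⟨k, hk⟩ := exists_isolated d
  obtain ⟨n, -, hn⟩ := exists_approximation (d + 1) (ε := 1 / 3) (by norm_num)
  refine ⟨n + k, fun P _ 𝒜 h𝒜 A hA μ hμ => ?_⟩
  obtain ⟨x, hx⟩ := hn P {q // q ∈ 𝒜} (fun q j => ¬ (j ∈ q.1 ↔ j ∈ A))
    (fun h => h𝒜 (ShattersSize.of_iff (fun j => j ∈ A) (ShattersSize.of_not h))) μ hμ
  -- A member agreeing with `A` on the sample has an empirical error of zero, hence a true error of
  -- at most `1/3`. Isolation within `ℬ` becomes isolation within `𝒜` once the sample points are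
  -- added.
  set ℬ := 𝒜.filter fun q => ∀ i, x i ∈ q ↔ x i ∈ A with hℬ
  obtain ⟨q, hq, S, hS, hiso⟩ := hk P ℬ ⟨A, mem_filter.2 ⟨hA, fun _ => Iff.rfl⟩⟩
    fun h => h𝒜 (ShattersSize.of_reindex
      (fun q : {q // q ∈ ℬ} => (⟨q.1, (mem_filter.1 q.2).1⟩ : {q // q ∈ 𝒜})) h)
  obtain ⟨hq𝒜, hqx⟩ := mem_filter.1 hq
  refine ⟨q, hq𝒜, ⟨univ.image x ∪ S, ?_, fun q' hq' h => ?_⟩, ?_⟩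
  · refine (card_union_le _ _).trans (add_le_add (card_image_le.trans ?_) hS)
    simp
  · refine hiso q' (mem_filter.2 ⟨hq', fun i => ?_⟩) fun y hy => h y (mem_union_right _ hy)
    rw [h (x i) (mem_union_left _ (mem_image_of_mem _ (mem_univ i))), hqx]
  · have h1 := hx ⟨q, hq𝒜⟩
    have h2 : (univ.filter fun i => ¬ (x i ∈ q ↔ x i ∈ A)) = ∅ :=
      filter_eq_empty_iff.2 fun i _ => not_not.2 (hqx i)
    simp only [h2, card_empty, Nat.cast_zero, zero_div] at h1
    have h3 := sum_filter_add_sum_filter_not univ (fun j => (j ∈ q ↔ j ∈ A)) μ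
    rw [hμ.2] at h3
    simp only [mul_ite, mul_one, mul_zero, ← sum_filter]
    linarith

open Classical in
/-- Each member of a family of bounded dimension is the majority vote of a bounded number of members
that are isolated by a bounded number of points. -/
theorem exists_majority (d : ℕ) : ∃ m T : ℕ, 0 < T ∧ ∀ (P : Type) [Fintype P] [Nonempty P]
    (𝒜 : Finset (Finset P)), ¬ ShattersSize (fun (q : {q // q ∈ 𝒜}) x => x ∈ q.1) (d + 1) →
    ∀ A ∈ 𝒜, ∃ q : Fin T → Finset P,
      (∀ t, q t ∈ 𝒜 ∧ ∃ S : Finset P, #S ≤ m ∧ Isolates 𝒜 S (q t)) ∧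
      ∀ j, j ∈ A ↔ T < 2 * #{t | j ∈ q t} := by
  obtain ⟨m, hm⟩ := exists_isolated_approximation d
  -- The roles of points and members are now exchanged, whence the dual bound `2 ^ (d + 1)`. The
  -- error `1/7` keeps a majority: `2/3 - 1/7 > 1/2`.
  obtain ⟨T, hT, happ⟩ := exists_approximation (2 ^ (d + 1)) (ε := 1 / 7) (by norm_num)
  refine ⟨m, T, hT, fun P _ _ 𝒜 h𝒜 A hA => ?_⟩
  let H := {q : Finset P // q ∈ 𝒜 ∧ ∃ S : Finset P, #S ≤ m ∧ Isolates 𝒜 S q}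
  obtain ⟨ν, hν, hνA⟩ := exists_mixed_strategy
    (fun (q : H) j => if (j ∈ q.1 ↔ j ∈ A) then (1 : ℝ) else 0) (2 / 3) fun μ hμ => by
      obtain ⟨q, hq, hS, h⟩ := hm P 𝒜 h𝒜 A hA μ hμ
      exact ⟨⟨q, hq, hS⟩, h⟩
  obtain ⟨x, hx⟩ := happ H P (fun j q => (j ∈ q.1 ↔ j ∈ A)) (fun h => h𝒜
    (ShattersSize.of_reindex (fun q : H => (⟨q.1, q.2.1⟩ : {q // q ∈ 𝒜}))
      (ShattersSize.of_iff (fun j => j ∈ A)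
        (ShattersSize.of_dual (R := fun (q : H) j => (j ∈ q.1 ↔ j ∈ A)) h)))) ν hν
  refine ⟨fun t => (x t).1, fun t => (x t).2, fun j => ?_⟩
  have h1 := hνA j
  have h2 := hx j
  simp only [mul_ite, mul_one, mul_zero, ← sum_filter] at h1
  have hT' : (0 : ℝ) < T := by exact_mod_cast hT
  have h3 : (T : ℝ) < 2 * #{t | (j ∈ (x t).1 ↔ j ∈ A)} := by
    have h4 : (2 / 3 - 1 / 7 : ℝ) ≤ #{t | (j ∈ (x t).1 ↔ j ∈ A)} / T := by
      refine (sub_le_sub_right h1 _).trans (le_of_eq_of_le ?_ (le_of_le_of_eq h2 ?_)) <;> congr!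
    rw [le_div_iff₀ hT'] at h4
    linarith
  have h4 : T < 2 * #{t | (j ∈ (x t).1 ↔ j ∈ A)} := by exact_mod_cast h3
  by_cases hj : j ∈ A
  · simpa [hj] using h4
  · have h5 := card_filter_add_card_filter_not (s := (univ : Finset (Fin T)))
      (fun t => j ∈ (x t).1)
    rw [card_univ, Fintype.card_fin] at h5
    simp only [hj, iff_false] at h4
    simp only [hj, false_iff, not_lt]
    omega

end VC

/-! ### From formulas to shattering -/

namespace POIndisc
open FirstOrder FirstOrder.Language
universe u v w
variable {L : FirstOrder.Language.{u, v}} {M : Type w} [L.Structure M] {α β : Type}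

theorem realize_signed {L' : FirstOrder.Language} {γ : Type} [L'.Structure M] (θ : L'.Formula γ)
    (t : Bool) (a : γ → M) : (signed θ t).Realize a ↔ (θ.Realize a ↔ t = true) := by
  cases t <;> simp [signed]

theorem realize_inst (φ : L.Formula (α ⊕ β)) (b : β → M) (a : α → M) :
    (inst φ b).Realize a ↔ φ.Realize (Sum.elim a b) := by
  rw [inst, Formula.Realize, ← BoundedFormula.realize_constantsVarsEquiv, Equiv.apply_symm_apply]
  change Formula.Realize _ _ ↔ _
  rw [Formula.realize_relabel]
  refine iff_of_eq (congrArg _ ?_)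
  ext (x | y)
  · rfl
  · rfl

theorem realize_deltaFormula [Finite α] (φ : L.Formula (α ⊕ β)) (n : ℕ) (s : Fin (n + 1) → Bool)
    (c : Fin (n + 1) → β → M) : (deltaFormula φ n s).Realize (fun v => c v.1 v.2) ↔
      ∃ a : α → M, ∀ i, φ.Realize (Sum.elim a (c i)) ↔ s i = true := by
  rw [deltaFormula, Formula.realize_iExs]
  refine exists_congr fun a => ?_
  rw [Formula.realize_iInf]
  refine forall_congr' fun i => ?_
  rw [realize_signed, Formula.realize_relabel]
  refine iff_congr (iff_of_eq (congrArg _ ?_)) Iff.rfl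
  ext (x | y) <;> rfl

theorem exists_realize_of_consistent {p : Set (L[[M]].Formula α)} (hp : Consistent p)
    (hfin : p.Finite) : ∃ a : α → M, ∀ θ ∈ p, θ.Realize a :=
  hp p subset_rfl hfin

/-- For finite `B`, consistency of a choice of signs means that a single tuple realises it. -/
theorem exists_independent_iff (φ : L.Formula (α ⊕ β)) (k : ℕ) :
    (∃ B : Finset (β → M), B.card = k ∧ Independent φ (B : Set (β → M))) ↔
      VC.ShattersSize (fun (a : α → M) (b : β → M) => φ.Realize (Sum.elim a b)) k := by
  classical
  constructor
  · rintro ⟨B, rfl, hB⟩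
    refine ⟨fun i => (B.equivFin.symm i : β → M), fun S => ?_⟩
    obtain ⟨a, ha⟩ := exists_realize_of_consistent (hB fun b => decide (B.equivFin b ∈ S))
      (Set.finite_range _)
    refine ⟨a, fun i => ?_⟩
    have h := ha _ ⟨B.equivFin.symm i, rfl⟩
    rw [realize_signed, realize_inst] at h
    simpa using h
  · rintro ⟨x, hx⟩
    have hinj := VC.ShattersSize.injective
      (R := fun (a : α → M) (b : β → M) => φ.Realize (Sum.elim a b)) hx
    refine ⟨Finset.univ.map ⟨x, hinj⟩, by simp, fun s F hF _ => ?_⟩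
    obtain ⟨a, ha⟩ := hx (Finset.univ.filter fun i => s ⟨x i, by simp⟩ = true)
    refine ⟨a, fun θ hθ => ?_⟩
    obtain ⟨⟨b, hb⟩, rfl⟩ := hF hθ
    obtain ⟨i, rfl⟩ : ∃ i, x i = b := by simpa using hb
    rw [realize_signed, realize_inst]
    exact (ha i).trans (by simp)

theorem not_shattersSize_of_hasIndependenceDimension {φ : L.Formula (α ⊕ β)} {N : ℕ}
    (h : HasIndependenceDimension M φ N) :
    ¬ VC.ShattersSize (fun (a : α → M) (b : β → M) => φ.Realize (Sum.elim a b)) (N + 1) := by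
  intro hs
  have := h.2 ((exists_independent_iff φ (N + 1)).2 hs)
  omega

/-- Shattering passes to smaller sizes, so the sizes of independent sets are bounded by `k`. A
greatest one exists because the empty set is independent, for which `M` must be nonempty. -/
theorem dependent_of_not_shattersSize [Nonempty M] {φ : L.Formula (α ⊕ β)} {k : ℕ}
    (h : ¬ VC.ShattersSize (fun (a : α → M) (b : β → M) => φ.Realize (Sum.elim a b)) k) :
    Dependent M φ := by
  have hset : {k : ℕ | ∃ B : Finset (β → M), B.card = k ∧ Independent φ (B : Set (β → M))} =
      {k | VC.ShattersSize (fun (a : α → M) (b : β → M) => φ.Realize (Sum.elim a b)) k} :=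
    Set.ext fun k => exists_independent_iff φ k
  have hbdd : ∀ l ∈ {k | VC.ShattersSize (fun (a : α → M) (b : β → M) =>
      φ.Realize (Sum.elim a b)) k}, l ≤ k := by
    intro l hl
    by_contra! hlt
    exact h (VC.ShattersSize.mono hl hlt.le)
  refine ⟨sSup {k | VC.ShattersSize (fun (a : α → M) (b : β → M) =>
    φ.Realize (Sum.elim a b)) k}, ?_⟩
  rw [HasIndependenceDimension, hset]
  exact ⟨Nat.sSup_mem ⟨0, Fin.elim0, fun _ => ⟨Classical.arbitrary _, fun i => i.elim0⟩⟩
    ⟨k, hbdd⟩, fun l hl => le_csSup ⟨k, hbdd⟩ hl⟩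

/-- Over a finite domain a `φ`-type is a finite set of formulas, so consistency gives an actual
realisation. -/
theorem exists_realize_iff_of_mem_phiTypes {P : Type} [Finite P] (φ : L.Formula (α ⊕ β))
    (b : P → β → M) {p : Set (L[[M]].Formula α)} (hp : p ∈ phiTypes φ (Set.range b)) :
    ∃ a : α → M, ∀ j, inst φ (b j) ∈ p ↔ φ.Realize (Sum.elim a (b j)) := by
  obtain ⟨h1, h2, h3⟩ := hp
  have hfin : p.Finite := by
    refine (Set.finite_range fun v : P × Bool => signed (inst φ (b v.1)) v.2).subset ?_
    intro θ hθ
    obtain ⟨_, ⟨j, rfl⟩, t, rfl⟩ := h1 θ hθ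
    exact ⟨(j, t), rfl⟩
  obtain ⟨a, ha⟩ := exists_realize_of_consistent h3 hfin
  refine ⟨a, fun j => ⟨fun h => (realize_inst φ (b j) a).1 (ha _ h), fun h => ?_⟩⟩
  obtain ⟨t, ht⟩ := h2 (b j) ⟨j, rfl⟩
  have h4 := ha _ ht
  rw [realize_signed, realize_inst] at h4
  have h5 := h4.1 h
  subst h5
  simpa [signed] using ht

/-- The `φ`-type over the range of `b` of a tuple `a`. -/
theorem exists_mem_phiTypes {P : Type} (φ : L.Formula (α ⊕ β)) (b : P → β → M) (a : α → M) :
    ∃ p ∈ phiTypes φ (Set.range b), ∀ j, inst φ (b j) ∈ p ↔ φ.Realize (Sum.elim a (b j)) := by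
  classical
  refine ⟨Set.range fun j => signed (inst φ (b j)) (decide (φ.Realize (Sum.elim a (b j)))),
    ⟨?_, ?_, fun F hF _ => ⟨a, fun θ hθ => ?_⟩⟩, fun j => ⟨?_, fun h => ⟨j, by simp [signed, h]⟩⟩⟩
  · rintro _ ⟨j, rfl⟩
    exact ⟨b j, ⟨j, rfl⟩, _, rfl⟩
  · rintro _ ⟨j, rfl⟩
    exact ⟨_, ⟨j, rfl⟩⟩
  · obtain ⟨j, rfl⟩ := hF hθ
    rw [realize_signed, realize_inst]
    simp
  · rintro ⟨i, hi⟩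
    rw [← realize_inst, ← hi, realize_signed, realize_inst]
    simp

/-! ### Uniform definability of types over finite sets -/

/-- The formula expressing that for more than half of the indices `t`, the `φ`-type over
`z_{t,0}, …, z_{t,m-1}` prescribed by the signs `s t` implies `φ(x; y)`. -/
noncomputable def voteFormula [Finite α] (φ : L.Formula (α ⊕ β)) {T m : ℕ}
    (s : Fin T × Fin m → Bool) : L.Formula (β ⊕ ((Fin T × Fin m) × β)) :=
  Formula.iSup fun G : {G : Finset (Fin T) // T < 2 * G.card} =>
    Formula.iInf fun t : {t // t ∈ G.1} => Formula.iAlls α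
      (Formula.imp
        (Formula.iInf fun k : Fin m => signed (φ.relabel (Sum.elim (fun a => Sum.inr a)
          (fun y => Sum.inl (Sum.inr ((t.1, k), y)))) :
            L.Formula ((β ⊕ ((Fin T × Fin m) × β)) ⊕ α)) (s (t.1, k)))
        (φ.relabel (Sum.elim (fun a => Sum.inr a) (fun y => Sum.inl (Sum.inl y)))))

open Classical in
theorem realize_voteFormula [Finite α] (φ : L.Formula (α ⊕ β)) {T m : ℕ}
    (s : Fin T × Fin m → Bool) (b : β → M) (c : Fin T × Fin m → β → M) :
    (voteFormula φ s).Realize (Sum.elim b fun v => c v.1 v.2) ↔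
      T < 2 * (Finset.univ.filter fun t : Fin T => ∀ a : α → M,
        (∀ k, φ.Realize (Sum.elim a (c (t, k))) ↔ s (t, k) = true) →
          φ.Realize (Sum.elim a b)).card := by
  have h1 : ∀ (t : Fin T) (a : α → M) (k : Fin m),
      (fun x => Sum.elim (Sum.elim b fun v : (Fin T × Fin m) × β => c v.1 v.2) a x) ∘
        Sum.elim (fun a => Sum.inr a) (fun y => Sum.inl (Sum.inr ((t, k), y))) =
      Sum.elim a (c (t, k)) := by
    intro t a k
    ext (x | y) <;> rfl
  have h2 : ∀ a : α → M,
      (fun x => Sum.elim (Sum.elim b fun v : (Fin T × Fin m) × β => c v.1 v.2) a x) ∘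
        Sum.elim (fun a => Sum.inr a) (fun y => Sum.inl (Sum.inl y)) = Sum.elim a b := by
    intro a
    ext (x | y) <;> rfl
  simp only [voteFormula, Formula.realize_iSup, Formula.realize_iInf, Formula.realize_iAlls,
    Formula.realize_imp, realize_signed, Formula.realize_relabel, h1, h2]
  constructor
  · rintro ⟨⟨G, hG⟩, h⟩
    refine hG.trans_le (Nat.mul_le_mul_left 2 (Finset.card_le_card fun t ht => ?_))
    exact Finset.mem_filter.2 ⟨Finset.mem_univ t, h ⟨t, ht⟩⟩
  · exact fun h => ⟨⟨_, h⟩, fun t => (Finset.mem_filter.1 t.2).2⟩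

/-- The tuple has a fixed length and is padded with an arbitrary point. Padding an isolating set is
harmless, as the extra points are given the signs of the isolated member. -/
theorem exists_range_superset {P : Type*} [Nonempty P] {m : ℕ} (S : Finset P) (hS : S.card ≤ m) :
    ∃ z : Fin (m + 1) → P, ∀ x ∈ S, ∃ k, z k = x := by
  refine ⟨fun k => if h : (k : ℕ) < S.card then S.equivFin.symm ⟨k, h⟩ else
    Classical.arbitrary P, fun x hx => ?_⟩
  have hlt := (S.equivFin ⟨x, hx⟩).2
  exact ⟨⟨S.equivFin ⟨x, hx⟩, by omega⟩, by simp [hlt]⟩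

/-- Uniform definability of types over finite sets: if `φ` shatters no `d + 1` tuples, then finitely
many formulas suffice to define all `φ`-types over finite sets. -/
theorem exists_uniform_definition [Finite α] (φ : L.Formula (α ⊕ β)) (d : ℕ)
    (hφ : ¬ VC.ShattersSize (fun (a : α → M) (b : β → M) => φ.Realize (Sum.elim a b)) (d + 1)) :
    ∃ T m : ℕ, 0 < T ∧ ∀ (P : Type) [Finite P] [Nonempty P] (b : P → β → M) (a : α → M),
      ∃ (s : Fin T × Fin (m + 1) → Bool) (z : Fin T × Fin (m + 1) → P), ∀ j,
        φ.Realize (Sum.elim a (b j)) ↔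
          (voteFormula φ s).Realize (Sum.elim (b j) fun v => b (z v.1) v.2) := by
  classical
  obtain ⟨m, T, hT, H⟩ := VC.exists_majority d
  refine ⟨T, m, hT, fun P _ _ b a => ?_⟩
  have := Fintype.ofFinite P
  let 𝒜 : Finset (Finset P) := Finset.univ.filter fun F =>
    ∃ a : α → M, ∀ j, j ∈ F ↔ φ.Realize (Sum.elim a (b j))
  have h𝒜 : ¬ VC.ShattersSize (fun (q : {q // q ∈ 𝒜}) x => x ∈ q.1) (d + 1) := by
    intro h
    choose g hg using fun q : {q // q ∈ 𝒜} => (Finset.mem_filter.1 q.2).2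
    have h' : (fun (q : {q // q ∈ 𝒜}) x => x ∈ q.1) =
        fun q x => φ.Realize (Sum.elim (g q) (b x)) := by
      ext q x
      exact hg q x
    rw [h'] at h
    exact hφ (VC.ShattersSize.of_comp b (VC.ShattersSize.of_reindex
      (R := fun (a : α → M) x => φ.Realize (Sum.elim a (b x))) g h))
  have hmem : ∀ a : α → M, (Finset.univ.filter fun j => φ.Realize (Sum.elim a (b j))) ∈ 𝒜 :=
    fun a => Finset.mem_filter.2 ⟨Finset.mem_univ _, a, fun j => by simp⟩
  obtain ⟨q, hq, hmaj⟩ := H P 𝒜 h𝒜 _ (hmem a)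
  choose hq𝒜 S hS hiso using hq
  choose z hz using fun t => exists_range_superset (S t) (hS t)
  refine ⟨fun v => decide (z v.1 v.2 ∈ q v.1), fun v => z v.1 v.2, fun j => ?_⟩
  rw [realize_voteFormula φ _ (b j) fun v => b (z v.1 v.2)]
  have hj := hmaj j
  rw [Finset.mem_filter] at hj
  simp only [Finset.mem_univ, true_and] at hj
  rw [hj]
  -- Every tuple with the prescribed signs on `z t` has trace `q t`, by isolation, and some tuple
  -- has this trace. Hence those signs imply `φ(x; b j)` exactly when `j ∈ q t`.
  have hfilter : (Finset.univ.filter fun t => j ∈ q t) = Finset.univ.filter fun t : Fin T =>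
      ∀ a : α → M, (∀ k, φ.Realize (Sum.elim a (b (z t k))) ↔ decide (z t k ∈ q t) = true) →
        φ.Realize (Sum.elim a (b j)) := by
    refine Finset.filter_congr fun t _ => ?_
    simp only [decide_eq_true_eq]
    constructor
    · intro hjt a' ha'
      have h := hiso t _ (hmem a') fun x hx => by
        obtain ⟨k, rfl⟩ := hz t x hx
        simpa using ha' k
      rw [← h] at hjt
      simpa using hjt
    · intro h
      obtain ⟨a', ha'⟩ := (Finset.mem_filter.1 (hq𝒜 t)).2
      exact (ha' j).2 (h a' fun k => (ha' _).symm)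
  rw [hfilter]

/-! ### The converse and the equivalence -/

/-- On distinct indices every pattern of signs is realised, so all of `Delta φ N` holds, whatever
the order on `P`. -/
theorem indiscernible_of_shatters [Finite α] (φ : L.Formula (α ⊕ β)) (N : ℕ) {P : Type}
    [PartialOrder P] (b : P → β → M)
    (hb : ∀ S : Set P, ∃ a : α → M, ∀ i, φ.Realize (Sum.elim a (b i)) ↔ i ∈ S) :
    Indiscernible (Delta φ N) b := by
  have h : ∀ i : Fin (N + 1) → P, Function.Injective i →
      tpDelta (Delta φ N) (fun k => b (i k)) = Delta φ N := by
    intro i hi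
    refine Set.ext fun δ => ⟨fun hδ => hδ.1, fun hδ => ⟨hδ, ?_⟩⟩
    obtain ⟨s, rfl⟩ := hδ
    refine (realize_deltaFormula φ N s fun k => b (i k)).2 ?_
    obtain ⟨a, ha⟩ := hb (i '' {k | s k = true})
    exact ⟨a, fun k => by rw [ha, hi.mem_set_image]; rfl⟩
  intro i j hi hj _
  rw [h i hi, h j hj]

end POIndisc

theorem theorem3p2 {L : FirstOrder.Language} (C : Type*) [L.Structure C] [Nonempty C]
    (m n : ℕ) (φ : L.Formula (Fin m ⊕ Fin n)) :
    POIndisc.Dependent C φ ↔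
      ∃ (N K r : ℕ) (ψ : Fin r → L.Formula (Fin n ⊕ (Fin (K + 1) × Fin n))),
        ∀ (P : Type) [PartialOrder P] [Finite P] [Nonempty P] (b : P → Fin n → C),
          POIndisc.Indiscernible (POIndisc.Delta φ N) b →
          ∀ p ∈ POIndisc.phiTypes φ (Set.range b),
            ∃ (l : Fin r) (i : Fin (K + 1) → P), ∀ j : P,
              POIndisc.inst φ (b j) ∈ p ↔
                (ψ l).Realize (Sum.elim (b j) (fun v => b (i v.1) v.2)) := by
  classical
  constructor
  · rintro ⟨d, hd⟩
    obtain ⟨T, k, hT, H⟩ := POIndisc.exists_uniform_definition φ d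
      (POIndisc.not_shattersSize_of_hasIndependenceDimension hd)
    obtain ⟨K, hK⟩ : ∃ K, T * (k + 1) = K + 1 :=
      Nat.exists_eq_succ_of_ne_zero (Nat.mul_pos hT k.succ_pos).ne'
    let e : Fin T × Fin (k + 1) ≃ Fin (K + 1) := Fintype.equivFinOfCardEq (by simp [hK])
    -- The signs cannot be parameters of a formula, so each pattern of signs gives its own `ψ`.
    let es := Fintype.equivFin (Fin T × Fin (k + 1) → Bool)
    refine ⟨0, K, _, fun l => (POIndisc.voteFormula φ (es.symm l)).relabel
      (Sum.map id (Prod.map e id)), fun P _ _ _ b _ p hp => ?_⟩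
    obtain ⟨a, ha⟩ := POIndisc.exists_realize_iff_of_mem_phiTypes φ b hp
    obtain ⟨s, z, hsz⟩ := H P b a
    refine ⟨es s, fun v => z (e.symm v), fun j => ?_⟩
    rw [ha, hsz, FirstOrder.Language.Formula.realize_relabel, Equiv.symm_apply_apply]
    refine iff_of_eq (congrArg _ ?_)
    ext (y | y) <;> simp
  · rintro ⟨N, K, r, ψ, H⟩
    -- On `k + 1` parameters at most `r * (k + 1) ^ (K + 1)` subsets are definable, whereas
    -- shattering would make all `2 ^ (k + 1)` definable.
    obtain ⟨k, hk⟩ : ∃ k : ℕ, r * (k + 1) ^ (K + 1) < 2 ^ (k + 1) := by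
      have h1 := (tendsto_pow_const_div_const_pow_of_one_lt (K + 1) (one_lt_two (α := ℝ))).const_mul
        (r : ℝ)
      rw [mul_zero] at h1
      obtain ⟨k, hk⟩ := (((Filter.tendsto_add_atTop_iff_nat 1).2 h1).eventually
        (gt_mem_nhds zero_lt_one)).exists
      refine ⟨k, ?_⟩
      rw [← mul_div_assoc, div_lt_one (by positivity)] at hk
      exact_mod_cast hk
    refine POIndisc.dependent_of_not_shattersSize (k := k + 1) ?_
    rintro ⟨b, hb⟩
    have hind := POIndisc.indiscernible_of_shatters φ N b fun S => by
      obtain ⟨a, ha⟩ := hb S.toFinset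
      exact ⟨a, fun i => by simp [ha]⟩
    have hdef : ∀ S : Finset (Fin (k + 1)), ∃ v : Fin r × (Fin (K + 1) → Fin (k + 1)), ∀ j,
        j ∈ S ↔ (ψ v.1).Realize (Sum.elim (b j) fun w => b (v.2 w.1) w.2) := by
      intro S
      obtain ⟨a, ha⟩ := hb S
      obtain ⟨p, hp, hpa⟩ := POIndisc.exists_mem_phiTypes φ b a
      obtain ⟨l, i, h⟩ := H (Fin (k + 1)) b hind p hp
      exact ⟨(l, i), fun j => (ha j).symm.trans ((hpa j).symm.trans (h j))⟩
    choose g hg using hdef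
    have hginj : Function.Injective g := fun S S' h => Finset.ext fun j => by
      rw [hg S j, hg S' j, h]
    have hcard := Fintype.card_le_of_injective g hginj
    simp only [Fintype.card_finset, Fintype.card_fin, Fintype.card_prod, Fintype.card_fun]
      at hcard
    omega
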